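/- \textbf{Theorem (Existence of baseray).} A \emph{generalized continuum} is a Hausdorff space that is connected (in particular nonempty), locally connected, $\sigma$-compact, and locally compact. A \emph{compact exhaustion} of a space $X$ is a sequence $K_1\subseteq K_2\subseteq\cdots$ of compact subsets with $X=\bigcup_i K_i$ and $K_i\subseteq \operatorname{int} K_{i+1}$ for all $i$; every generalized continuum has one. A subset of $X$ is \emph{unbounded} if its closure in $X$ is not compact. An \emph{end} of $X$ (with respect to $\{K_i\}$) is a sequence $\varepsilon=(V_1,V_2,\ldots)$ with $V_1\supseteq V_2\supseteq\cdots$, where each $V_i$ is an unbounded connected component of $X-K_i$. A continuous map is \emph{proper} if preimages of compact sets are compact. If $f:Y\to X$ is proper, then $\{f^{-1}(K_i)\}$ is a compact exhaustion of $Y$, and $f$ induces a map from the ends of $Y$ with respect to $\{f^{-1}(K_i)\}$ to the ends of $X$ with respect to $\{K_i\}$, which sends $(U_1,U_2,\ldots)$ to $(V_1,V_2,\ldots)$, where $V_i$ is the component of $X-K_i$ that contains $f(U_i)$. The half-line $[0,\infty)$ has exactly one end, denoted $\infty$; a proper map $r:[0,\infty)\to X$ \emph{points to} the end $\varepsilon$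 of $X$ if the map on ends induced by $r$ sends $\infty$ to $\varepsilon$. Let $X$ be a noncompact, metrizable generalized continuum, and let $\{K_i\}$ be any compact exhaustion of $X$. Then $X$ has at least one end with respect to $\{K_i\}$. Furthermore, if $\varepsilon$ is any end of $X$ with respect to $\{K_i\}$, then there exists a proper embedding $r:[0,\infty)\to X$ (a proper map that is a homeomorphism onto its image) such that $r$ points to $\varepsilon$. -/

import Mathlib

open Set Topology
open scoped NNReal

/-- A generalized continuum: a Hausdorff space that is connected (hence nonempty),
locally connected, `σ`-compact and locally compact. -/
class GeneralizedContinuum (X : Type*) [TopologicalSpace X] : Prop extends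
  T2Space X, ConnectedSpace X, LocallyConnectedSpace X, SigmaCompactSpace X, LocallyCompactSpace X

/-- The unbounded components of a subspace `V` of `X`: the connected components of `V` whose
closure in `X` is not compact. -/
def unboundedComponents {X : Type*} [TopologicalSpace X] (V : Set X) : Set (Set X) :=
  {C | (∃ x ∈ V, C = connectedComponentIn V x) ∧ ¬ IsCompact (closure C)}

namespace CompactExhaustion

variable {X Y : Type*} [TopologicalSpace X] [TopologicalSpace Y]

/-- The ends of `X` with respect to a compact exhaustion `K`: nested sequences
`V 0 ⊇ V 1 ⊇ V 2 ⊇ ⋯` where `V i` is an unbounded component of `X - K i`. -/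
@[ext]
structure Ends (K : CompactExhaustion X) where
  comp : ℕ → Set X
  comp_mem : ∀ i, comp i ∈ unboundedComponents (K i)ᶜ
  comp_succ_subset : ∀ i, comp (i + 1) ⊆ comp i

/-- The preimage of a compact exhaustion of `X` under a proper map `f : Y → X` is a compact
exhaustion of `Y`. -/
def preimage (K : CompactExhaustion X) {f : Y → X} (hf : IsProperMap f) :
    CompactExhaustion Y where
  toFun i := f ⁻¹' K i
  isCompact' i := hf.isCompact_preimage (K.isCompact i)
  subset_interior_succ' i :=
    (preimage_mono (K.subset_interior_succ i)).trans
      (preimage_interior_subset_interior_preimage hf.continuous)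
  iUnion_eq' := by rw [← preimage_iUnion, K.iUnion_eq, preimage_univ]

theorem coe_preimage (K : CompactExhaustion X) {f : Y → X} (hf : IsProperMap f) (i : ℕ) :
    K.preimage hf i = f ⁻¹' K i := rfl

/-- The map on ends induced by a proper map `f : Y → X`. It sends the end `(U i)` to the end whose
`i`-th term is the component of `X - K i` that contains `f (U i)`; see `image_subset_endsMap` and
`endsMap_comp_eq`. (The components in the union below all coincide.) -/
def endsMap (K : CompactExhaustion X) {f : Y → X} (hf : IsProperMap f)
    (α : (K.preimage hf).Ends) : K.Ends where
  comp i := ⋃ y ∈ α.comp i, connectedComponentIn (K i)ᶜ (f y)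
  comp_mem i := by
    obtain ⟨⟨y, hy, hU⟩, hub⟩ := α.comp_mem i
    have hsub : ∀ z ∈ α.comp i, f z ∈ connectedComponentIn (K i)ᶜ (f y) := by
      intro z hz
      rw [hU] at hz
      exact connectedComponentIn_mono (f y) (image_subset_iff.2 subset_rfl)
        (hf.continuous.continuousOn.mapsTo_connectedComponentIn hy hz)
    have hyU : y ∈ α.comp i := hU ▸ mem_connectedComponentIn hy
    have heq : (⋃ z ∈ α.comp i, connectedComponentIn (K i)ᶜ (f z)) =
        connectedComponentIn (K i)ᶜ (f y) := by
      apply subset_antisymm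
      · refine iUnion₂_subset fun z hz => ?_
        rw [connectedComponentIn_eq (hsub z hz)]
      · exact subset_biUnion_of_mem (u := fun z => connectedComponentIn (K i)ᶜ (f z)) hyU
    rw [heq]
    refine ⟨⟨f y, hy, rfl⟩, fun hc => hub ?_⟩
    refine (hf.isCompact_preimage hc).of_isClosed_subset isClosed_closure ?_
    exact closure_minimal (fun z hz => subset_closure (hsub z hz))
      (isClosed_closure.preimage hf.continuous)
  comp_succ_subset i := by
    refine iUnion₂_subset fun y hy => ?_
    refine (connectedComponentIn_mono (f y)
      (compl_subset_compl.2 (K.subset_succ i))).trans ?_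
    exact subset_biUnion_of_mem (u := fun z => connectedComponentIn (K i)ᶜ (f z))
      (α.comp_succ_subset i hy)

theorem image_subset_endsMap (K : CompactExhaustion X) {f : Y → X} (hf : IsProperMap f)
    (α : (K.preimage hf).Ends) (i : ℕ) : f '' α.comp i ⊆ (K.endsMap hf α).comp i := by
  rintro _ ⟨y, hy, rfl⟩
  obtain ⟨⟨x, -, hU⟩, -⟩ := α.comp_mem i
  have hyK : y ∈ (K.preimage hf i)ᶜ := connectedComponentIn_subset _ x (hU ▸ hy)
  exact mem_biUnion hy (mem_connectedComponentIn (F := (K i)ᶜ) hyK)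

theorem endsMap_comp_eq (K : CompactExhaustion X) {f : Y → X} (hf : IsProperMap f)
    (α : (K.preimage hf).Ends) (i : ℕ) {C : Set X} (hC : C ∈ unboundedComponents (K i)ᶜ)
    (hfC : f '' α.comp i ⊆ C) : (K.endsMap hf α).comp i = C := by
  obtain ⟨⟨c, -, rfl⟩, -⟩ := hC
  obtain ⟨⟨d, -, hd⟩, -⟩ := (K.endsMap hf α).comp_mem i
  obtain ⟨⟨x, hx, hU⟩, -⟩ := α.comp_mem i
  have hxU : x ∈ α.comp i := hU ▸ mem_connectedComponentIn hx
  have h1 := K.image_subset_endsMap hf α i (mem_image_of_mem f hxU)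
  have h2 := hfC (mem_image_of_mem f hxU)
  rw [hd] at h1 ⊢
  rw [connectedComponentIn_eq h1, connectedComponentIn_eq h2]

/-- The end `∞` of the half-line `[0, ∞)`, with respect to a compact exhaustion `L`: its `i`-th
term is the final segment of all `t` such that `[t, ∞)` misses `L i`. -/
def endInfty (L : CompactExhaustion ℝ≥0) : L.Ends where
  comp i := {t | ∀ s, t ≤ s → s ∉ L i}
  comp_mem i := by
    obtain ⟨B, hB⟩ := (L.isCompact i).bddAbove
    have hb : ∀ s, B + 1 ≤ s → s ∉ L i := fun s hs hsL =>
      absurd ((lt_add_one B).trans_le hs) (not_lt.2 (hB hsL))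
    refine ⟨⟨B + 1, hb _ le_rfl, ?_⟩, fun hc => ?_⟩
    · apply subset_antisymm
      · refine IsPreconnected.subset_connectedComponentIn ?_ hb fun t ht => ht t le_rfl
        have ho : OrdConnected {t : ℝ≥0 | ∀ s, t ≤ s → s ∉ L i} :=
          ⟨fun _ ha _ _ _ hc s hs => ha s (hc.1.trans hs)⟩
        exact ho.isPreconnected
      · intro t ht s hs
        rcases le_total (B + 1) s with h | h
        · exact hb s h
        · have ho := (isPreconnected_connectedComponentIn
            (F := (L i)ᶜ) (x := B + 1)).ordConnected
          exact connectedComponentIn_subset _ _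
            (ho.out ht (mem_connectedComponentIn (F := (L i)ᶜ) (hb _ le_rfl)) ⟨hs, h⟩)
    · obtain ⟨M, hM⟩ := hc.bddAbove
      have h : max M B + 1 ∈ {t : ℝ≥0 | ∀ s, t ≤ s → s ∉ L i} := fun s hs =>
        hb s (le_trans (by gcongr; exact le_max_right _ _) hs)
      exact absurd ((le_max_left M B).trans_lt (lt_add_one _)) (not_lt.2 (hM (subset_closure h)))
  comp_succ_subset i := fun t ht s hs hsL => ht s hs (L.subset_succ i hsL)

/-- `∞` is the only end of `[0, ∞)`. -/
theorem eq_endInfty (L : CompactExhaustion ℝ≥0) (α : L.Ends) : α = L.endInfty := by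
  ext1
  funext i
  obtain ⟨⟨x, -, hU⟩, hub⟩ := α.comp_mem i
  obtain ⟨⟨y, -, hV⟩, -⟩ := L.endInfty.comp_mem i
  obtain ⟨B, hB⟩ := (L.isCompact i).bddAbove
  have hex : ∃ t ∈ α.comp i, B + 1 ≤ t := by
    by_contra! h
    refine hub (isCompact_Icc.of_isClosed_subset (s := Icc 0 (B + 1)) isClosed_closure ?_)
    exact closure_minimal (fun t ht => ⟨zero_le, (h t ht).le⟩) isClosed_Icc
  obtain ⟨t, ht, htB⟩ := hex
  have ht' : t ∈ L.endInfty.comp i := fun s hs hsL =>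
    absurd ((lt_add_one B).trans_le (htB.trans hs)) (not_lt.2 (hB hsL))
  rw [hU] at ht ⊢
  rw [hV] at ht' ⊢
  rw [connectedComponentIn_eq ht, connectedComponentIn_eq ht']

/-- A proper map `r : [0, ∞) → X` points to the end `ε` of `X` if the map on ends induced by `r`
sends the end `∞` of `[0, ∞)` to `ε`. -/
def PointsTo (K : CompactExhaustion X) {r : ℝ≥0 → X} (hr : IsProperMap r) (ε : K.Ends) : Prop :=
  K.endsMap hr (K.preimage hr).endInfty = ε

end CompactExhaustion

open Filter

/-! An end exists because an ultrafilter finer than the cocompact filter selects one component of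
each `(K i)ᶜ`; two selected components always meet, which makes them nested
(`GeneralizedContinuum.nonempty_ends`).

The terms of an end are nested connected open sets that leave every compact set. The ray is built
inside them as an arc is built from ever finer simple chains, with the half-line in place of the
interval. Connectedness and local compactness yield an infinite chain of relatively compact
connected open links in which only neighbours meet (`OpenTrail.exists_refinement`). Each chain is
refined again, with stage-`n` diameters at most `(1 / 2) ^ n`, and the half-line is subdivided in
step with the links (`exists_subdivision`). A parameter then selects nested links whose compact
closures share exactly one point (`OpenChain.exists_injective_ray`). Small links give continuity,
disjointness of distant links gives injectivity, and leaving every compact set gives properness,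
hence a closed embedding. -/

/-! ### Walks, shortcuts and separation of chains. -/

theorem IsPreconnected.transGen_of_eventually {X : Type*} [TopologicalSpace X] {G : Set X}
    (hG : IsPreconnected G) {R : X → X → Prop} (hsymm : ∀ x y, R x y → R y x)
    (hloc : ∀ x ∈ G, ∀ᶠ y in 𝓝 x, R x y) {x y : X} (hx : x ∈ G) (hy : y ∈ G) :
    Relation.TransGen R x y := by
  refine hG.induction₂ (Relation.TransGen R) (fun x hx => ?_) ?_ ?_ hx hy
  · filter_upwards [mem_nhdsWithin_of_mem_nhds (hloc x hx)] with y hy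
    exact .single hy
  · intro a b c _ _ _ h1 h2
    exact h1.trans h2
  · intro a b _ _ h
    rw [← Relation.transGen_swap]
    exact Relation.TransGen.mono (fun u v huv => hsymm u v huv) _ _ h

theorem Relation.TransGen.exists_seq {α : Type*} {R : α → α → Prop} {x y : α}
    (h : Relation.TransGen R x y) :
    ∃ (N : ℕ) (q : ℕ → α), q 0 = x ∧ q (N + 1) = y ∧ ∀ k ≤ N, R (q k) (q (k + 1)) := by
  induction h with
  | @single b h =>
    refine ⟨0, fun k => if k = 0 then x else b, by simp, by simp, fun k hk => ?_⟩
    obtain rfl : k = 0 := by omega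
    simpa using h
  | @tail b c _ h ih =>
    obtain ⟨N, q, h0, h1, h2⟩ := ih
    refine ⟨N + 1, fun k => if k ≤ N + 1 then q k else c, by simpa using h0, by simp, ?_⟩
    intro k hk
    rcases hk.lt_or_eq with hk | rfl
    · have h3 : k ≤ N := by omega
      have h4 : k ≤ N + 1 := by omega
      simpa [h3, h4] using h2 k h3
    · simpa [h1] using h

/-- Infinitely many finite walks, each of which starts where the one before it ends, can be
joined to one infinite walk. -/
theorem exists_walk_of_transGen {α : Type*} {R : ℕ → α → α → Prop} {p : ℕ → α}
    (h : ∀ i, Relation.TransGen (R i) (p i) (p (i + 1))) :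
    ∃ (lab : ℕ → ℕ) (z : ℕ → α), lab 0 = 0 ∧ Monotone lab ∧ Tendsto lab atTop atTop ∧
      ∀ k, R (lab k) (z k) (z (k + 1)) := by
  choose N q h0 h1 h2 using fun i => (h i).exists_seq
  -- The state `(i, d)` stands for step `d` of walk `i`, whose steps are numbered `0, …, N i`.
  let next : ℕ × ℕ → ℕ × ℕ := fun s => if s.2 < N s.1 then (s.1, s.2 + 1) else (s.1 + 1, 0)
  let st : ℕ → ℕ × ℕ := fun k => next^[k] (0, 0)
  have hst : ∀ k, st (k + 1) = next (st k) := fun k => Function.iterate_succ_apply' _ _ _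
  have hle : ∀ k, (st k).2 ≤ N (st k).1 := by
    intro k
    induction k with
    | zero => exact Nat.zero_le _
    | succ k ih =>
      rw [hst]
      by_cases hk : (st k).2 < N (st k).1
      · simp only [next, hk, if_true]; omega
      · simp [next, hk]
  have hmono : Monotone fun k => (st k).1 := by
    refine monotone_nat_of_le_succ fun k => ?_
    rw [hst]
    by_cases hk : (st k).2 < N (st k).1 <;> simp [next, hk]
  have hreach : ∀ i, ∃ k, st k = (i, 0) := by
    intro i
    induction i with
    | zero => exact ⟨0, rfl⟩
    | succ i ih =>
      obtain ⟨k, hk⟩ := ih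
      have hd : ∀ d ≤ N i, st (k + d) = (i, d) := by
        intro d
        induction d with
        | zero => intro _; exact hk
        | succ d ih =>
          intro hd
          have hlt : d < N i := by omega
          rw [← add_assoc, hst, ih hlt.le]
          simp [next, hlt]
      refine ⟨k + N i + 1, ?_⟩
      rw [hst, hd _ le_rfl]
      simp [next]
  refine ⟨fun k => (st k).1, fun k => q (st k).1 (st k).2, rfl, hmono, ?_, fun k => ?_⟩
  · refine tendsto_atTop_atTop_of_monotone hmono fun i => ?_
    obtain ⟨k, hk⟩ := hreach i
    exact ⟨k, by simp [hk]⟩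
  · have := h2 (st k).1 (st k).2 (hle k)
    simp only [hst]
    by_cases hk : (st k).2 < N (st k).1
    · simpa [next, hk] using this
    · have he : (st k).2 = N (st k).1 := le_antisymm (hle k) (not_lt.1 hk)
      rw [he, h1] at this
      simpa [next, hk, h0, he] using this

/-- Jumping each time to the last vertex that is related to the current one turns a walk into a
walk without shortcuts. -/
theorem exists_strictMono_no_shortcut {M : ℕ → ℕ → Prop} (hsucc : ∀ k, M k (k + 1))
    (hbdd : ∀ k, BddAbove {l | M k l}) :
    ∃ φ : ℕ → ℕ, StrictMono φ ∧ φ 0 = 0 ∧ (∀ j, M (φ j) (φ (j + 1))) ∧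
      ∀ i j, i + 2 ≤ j → ¬ M (φ i) (φ j) := by
  let next : ℕ → ℕ := fun k => sSup {l | M k l}
  have hmem : ∀ k, M k (next k) := fun k => Nat.sSup_mem ⟨k + 1, hsucc k⟩ (hbdd k)
  have hle : ∀ k l, M k l → l ≤ next k := fun k l h => le_csSup (hbdd k) h
  have hφ : ∀ j, next^[j + 1] 0 = next (next^[j] 0) := fun j =>
    Function.iterate_succ_apply' _ _ _
  have hmono : StrictMono fun j => next^[j] 0 := by
    refine strictMono_nat_of_lt_succ fun j => ?_
    rw [hφ]
    exact hle _ _ (hsucc _)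
  refine ⟨fun j => next^[j] 0, hmono, rfl, fun j => ?_, fun i j hij hM => ?_⟩
  · simp only [hφ]; exact hmem _
  · have h1 := hle _ _ hM
    rw [← hφ] at h1
    exact absurd h1 (not_le.2 (hmono (by omega)))

/-- A locally finite sequence of closed sets in which only neighbours meet has an open expansion
in which only neighbours meet. -/
theorem LocallyFinite.exists_open_expansion {X : Type*} [MetricSpace X] {C : ℕ → Set X}
    (hC : LocallyFinite C) (hclosed : ∀ j, IsClosed (C j)) (hne : ∀ j, (C j).Nonempty)
    (hdisj : ∀ i j, i + 2 ≤ j → Disjoint (C i) (C j)) :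
    ∃ T : ℕ → Set X, (∀ j, IsOpen (T j)) ∧ (∀ j, C j ⊆ T j) ∧
      ∀ i j, i + 2 ≤ j → Disjoint (T i) (T j) := by
  let F : ℕ → Set X := fun j => ⋃ l : {l // j + 2 ≤ l ∨ l + 2 ≤ j}, C l
  have hF : ∀ j, IsClosed (F j) := fun j =>
    (hC.comp_injective Subtype.val_injective).isClosed_iUnion fun l => hclosed l
  have hCF : ∀ j l, (j + 2 ≤ l ∨ l + 2 ≤ j) → C l ⊆ F j := fun j l h =>
    subset_iUnion (fun l : {l // j + 2 ≤ l ∨ l + 2 ≤ j} => C l) ⟨l, h⟩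
  -- `Metric.infDist` to the empty set is `0`, so positivity off `F j` needs a point in `F j`.
  have hFne : ∀ j, (F j).Nonempty := fun j => (hne (j + 2)).mono (hCF _ _ (.inl le_rfl))
  refine ⟨fun j => {x | 2 * Metric.infDist x (C j) < Metric.infDist x (F j)}, fun j => ?_,
    fun j x hx => ?_, fun i j hij => ?_⟩
  · exact isOpen_lt ((Metric.continuous_infDist_pt _).const_mul 2 |>.comp continuous_id)
      (Metric.continuous_infDist_pt _)
  · have hxF : x ∉ F j := by
      intro h
      obtain ⟨⟨l, hl⟩, hxl⟩ := mem_iUnion.1 h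
      rcases hl with hl | hl
      · exact (hdisj _ _ hl).le_bot ⟨hx, hxl⟩
      · exact (hdisj _ _ hl).le_bot ⟨hxl, hx⟩
    have := ((hF j).notMem_iff_infDist_pos (hFne j)).1 hxF
    simpa [Metric.infDist_zero_of_mem hx] using this
  · rw [Set.disjoint_left]
    intro x hi hj
    simp only [mem_ofPred_eq] at hi hj
    have h1 := Metric.infDist_le_infDist_of_subset (x := x) (hCF i j (.inl hij)) (hne j)
    have h2 := Metric.infDist_le_infDist_of_subset (x := x) (hCF j i (.inr hij)) (hne i)
    have h3 := Metric.infDist_nonneg (x := x) (s := C i)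
    have h4 := Metric.infDist_nonneg (x := x) (s := C j)
    linarith

/-! ### Existence of ends. -/

/-- The ends of a noncompact generalized continuum: an ultrafilter that contains the complements
of all compact sets singles out one component of each `(K i)ᶜ`. -/
theorem GeneralizedContinuum.nonempty_ends {X : Type*} [TopologicalSpace X]
    [GeneralizedContinuum X] [NoncompactSpace X] (K : CompactExhaustion X) : Nonempty K.Ends := by
  let F : Ultrafilter X := Ultrafilter.of (cocompact X)
  have hF : ∀ s, IsCompact s → sᶜ ∈ F := fun s hs =>
    Ultrafilter.of_le (cocompact X) hs.compl_mem_cocompact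
  have hcomp : ∀ i, ∃ x ∈ (K i)ᶜ, connectedComponentIn (K i)ᶜ x ∈ F := by
    intro i
    have hopen : ∀ x, IsOpen (connectedComponentIn (K i)ᶜ x) := fun x =>
      (K.isCompact i).isClosed.isOpen_compl.connectedComponentIn
    -- The compact frontier is covered by finitely many components. If every component that leaves
    -- `K (i + 1)` meets it, those finitely many cover `(K (i + 1))ᶜ`, and the ultrafilter contains
    -- one of them.
    by_cases hfr : ∀ x ∈ (K (i + 1))ᶜ,
        (connectedComponentIn (K i)ᶜ x ∩ frontier (K (i + 1))).Nonempty
    · have hsub : frontier (K (i + 1)) ⊆ (K i)ᶜ := fun x hx hxK =>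
        hx.2 (K.subset_interior_succ i hxK)
      have hcpt : IsCompact (frontier (K (i + 1))) :=
        (K.isCompact (i + 1)).of_isClosed_subset isClosed_frontier
          (K.isCompact (i + 1)).isClosed.frontier_subset
      obtain ⟨S, hS, hScov⟩ := hcpt.elim_nhds_subcover (connectedComponentIn (K i)ᶜ)
        fun x hx => (hopen x).mem_nhds (mem_connectedComponentIn (hsub hx))
      have hmem : (⋃ x ∈ (S : Set X), connectedComponentIn (K i)ᶜ x) ∈ F := by
        refine mem_of_superset (hF _ (K.isCompact (i + 1))) fun x hx => ?_
        obtain ⟨y, hy, hyf⟩ := hfr x hx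
        obtain ⟨z, hz, hyz⟩ := mem_iUnion₂.1 (hScov hyf)
        refine mem_iUnion₂.2 ⟨z, hz, ?_⟩
        rw [connectedComponentIn_eq hyz, ← connectedComponentIn_eq hy]
        exact mem_connectedComponentIn fun h => hx (K.subset_succ i h)
      obtain ⟨x, hx, hxF⟩ := (Ultrafilter.finite_biUnion_mem_iff S.finite_toSet).1 hmem
      exact ⟨x, hsub (hS x hx), hxF⟩
    · push Not at hfr
      obtain ⟨x, hx, hemp⟩ := hfr
      have hxi : x ∈ (K i)ᶜ := fun h => hx (K.subset_succ i h)
      refine ⟨x, hxi, ?_⟩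
      set C := connectedComponentIn (K i)ᶜ x with hC
      have hxC : x ∈ C := mem_connectedComponentIn hxi
      have hclC : closure C ∩ (K i)ᶜ ⊆ C :=
        (isPreconnected_connectedComponentIn.subset_closure
          (subset_inter subset_closure (connectedComponentIn_subset _ _))
          inter_subset_left).subset_connectedComponentIn ⟨subset_closure hxC, hxi⟩
          inter_subset_right
      -- Since `C` misses the frontier, its part outside `K (i + 1)` is clopen and nonempty, hence
      -- all of `X`.
      have hclosed : IsClosed (C ∩ (K (i + 1))ᶜ) := by
        refine isClosed_of_closure_subset fun y hy => ?_
        have hy2 : y ∈ (interior (K (i + 1)))ᶜ := by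
          rw [← closure_compl]; exact closure_mono inter_subset_right hy
        have hyC : y ∈ C := hclC ⟨closure_mono inter_subset_left hy,
          fun h => hy2 (K.subset_interior_succ i h)⟩
        exact ⟨hyC, fun h => (Set.eq_empty_iff_forall_notMem.1 hemp y)
          ⟨hyC, subset_closure h, hy2⟩⟩
      have huniv := IsClopen.eq_univ ⟨hclosed,
        (hopen x).inter (K.isCompact (i + 1)).isClosed.isOpen_compl⟩ ⟨x, hxC, hx⟩
      exact mem_of_superset (huniv ▸ univ_mem) inter_subset_left
  choose x hx hxF using hcomp
  refine ⟨⟨fun i => connectedComponentIn (K i)ᶜ (x i), fun i => ⟨⟨x i, hx i, rfl⟩, fun hc => ?_⟩,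
    fun i => ?_⟩⟩
  · obtain ⟨y, hy, hy'⟩ := F.nonempty_of_mem (inter_mem (hF _ hc) (hxF i))
    exact hy (subset_closure hy')
  · obtain ⟨y, hy, hy'⟩ := F.nonempty_of_mem (inter_mem (hxF i) (hxF (i + 1)))
    rw [connectedComponentIn_eq hy, connectedComponentIn_eq hy']
    exact connectedComponentIn_mono y (compl_subset_compl.2 (K.subset_succ i))

/-! ### Open chains and their refinements. -/

/-- A sequence of connected open sets, each of which meets the next one, that eventually
stays inside each of the sets `V i`. -/
structure OpenTrail {X : Type*} [TopologicalSpace X] (V : ℕ → Set X) where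
  link : ℕ → Set X
  pt : ℕ → X
  isOpen_link : ∀ j, IsOpen (link j)
  isPreconnected_link : ∀ j, IsPreconnected (link j)
  pt_mem : ∀ j, pt j ∈ link j
  pt_succ_mem : ∀ j, pt (j + 1) ∈ link j
  eventually_subset : ∀ i, ∀ᶠ j in atTop, link j ⊆ V i

/-- An open trail with relatively compact links, in which only neighbours meet. -/
structure OpenChain {X : Type*} [TopologicalSpace X] (V : ℕ → Set X) extends OpenTrail V where
  isCompact_closure : ∀ j, IsCompact (closure (link j))
  disjoint : ∀ i j, i + 2 ≤ j → Disjoint (closure (link i)) (closure (link j))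

/-- Two points are linked if they lie in a compact connected set that has an open neighbourhood
contained in `G` all of whose subsets satisfy `sm`. -/
def Linked {X : Type*} [TopologicalSpace X] (G : Set X) (sm : Set X → Prop) (x y : X) : Prop :=
  ∃ C N : Set X, IsCompact C ∧ IsPreconnected C ∧ C ⊆ N ∧ IsOpen N ∧ N ⊆ G ∧
    (∀ S ⊆ N, sm S) ∧ x ∈ C ∧ y ∈ C

/-- The compact connected set is the closure of a connected open neighbourhood of `x` inside a
compact one. This is the local input for `IsPreconnected.transGen_of_eventually`. -/
theorem Linked.eventually {X : Type*} [TopologicalSpace X] [T2Space X] [LocallyConnectedSpace X]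
    [LocallyCompactSpace X] {G : Set X} {sm : Set X → Prop} (hG : IsOpen G) {x : X} (hx : x ∈ G)
    (hsm : ∀ᶠ N in (𝓝 x).smallSets, sm N) : ∀ᶠ y in 𝓝 x, Linked G sm x y := by
  obtain ⟨s, hs, hsm⟩ := eventually_smallSets.1 hsm
  have hU : interior s ∩ G ∈ 𝓝 x := inter_mem (interior_mem_nhds.2 hs) (hG.mem_nhds hx)
  obtain ⟨Q, hQ, hQU, hQc⟩ := local_compact_nhds hU
  have hxQ : x ∈ interior Q := mem_interior_iff_mem_nhds.2 hQ
  have hsub : closure (connectedComponentIn (interior Q) x) ⊆ Q :=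
    closure_minimal ((connectedComponentIn_subset _ _).trans interior_subset) hQc.isClosed
  filter_upwards [isOpen_interior.connectedComponentIn.mem_nhds (mem_connectedComponentIn hxQ)]
    with y hy
  exact ⟨closure (connectedComponentIn (interior Q) x), interior s ∩ G,
    hQc.of_isClosed_subset isClosed_closure hsub, isPreconnected_connectedComponentIn.closure,
    hsub.trans hQU, isOpen_interior.inter hG, inter_subset_right,
    fun S hS => hsm S ((hS.trans inter_subset_left).trans interior_subset),
    subset_closure (mem_connectedComponentIn hxQ), subset_closure hy⟩

/-- An open trail is refined by an open chain with arbitrarily small links. -/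
theorem OpenTrail.exists_refinement {X : Type*} [MetricSpace X] [LocallyConnectedSpace X]
    [LocallyCompactSpace X] {V : ℕ → Set X} (hV : ∀ C, IsCompact C → ∃ i, Disjoint C (V i))
    (G : OpenTrail V) {sm : ℕ → Set X → Prop}
    (hsm : ∀ i, ∀ x ∈ G.link i, ∀ᶠ N in (𝓝 x).smallSets, sm i N) :
    ∃ (O : OpenChain V) (lab : ℕ → ℕ), lab 0 = 0 ∧ Monotone lab ∧ Tendsto lab atTop atTop ∧
      ∀ j, closure (O.link j) ⊆ G.link (lab j) ∧ sm (lab j) (closure (O.link j)) := by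
  have htrans : ∀ i, Relation.TransGen (Linked (G.link i) (sm i)) (G.pt i) (G.pt (i + 1)) :=
    fun i => (G.isPreconnected_link i).transGen_of_eventually
      (fun x y ⟨C, N, h1, h2, h3, h4, h5, h6, hx, hy⟩ => ⟨C, N, h1, h2, h3, h4, h5, h6, hy, hx⟩)
      (fun x hx => Linked.eventually (G.isOpen_link i) hx (hsm i x hx))
      (G.pt_mem i) (G.pt_succ_mem i)
  obtain ⟨lab, z, hlab0, hlabm, hlabt, hz⟩ := exists_walk_of_transGen htrans
  choose C N hCc hCp hCN hNo hNG hNsm hzC hzC' using hz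
  have hNV : ∀ i, ∀ᶠ k in atTop, N k ⊆ V i := fun i =>
    (hlabt.eventually (G.eventually_subset i)).mono fun k hk => (hNG k).trans hk
  have havoid : ∀ D, IsCompact D → ∀ᶠ k in atTop, Disjoint D (C k) := by
    intro D hD
    obtain ⟨i, hi⟩ := hV D hD
    exact (hNV i).mono fun k hk => hi.mono_right ((hCN k).trans hk)
  -- The sets `C l` eventually miss the compact set `C k`, so there is a last one that meets it.
  obtain ⟨φ, hφ, hφ0, hφs, hφd⟩ :=
    exists_strictMono_no_shortcut (M := fun k l => (C k ∩ C l).Nonempty)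
      (fun k => ⟨z (k + 1), hzC' k, hzC (k + 1)⟩) (by
        intro k
        obtain ⟨B, hB⟩ := eventually_atTop.1 (havoid (C k) (hCc k))
        refine ⟨B, fun l hl => ?_⟩
        by_contra hlt
        exact (Set.not_disjoint_iff_nonempty_inter.2 hl) (hB l (by omega)))
  have hlf : LocallyFinite C := by
    intro x
    obtain ⟨D, hD, hxD⟩ := exists_compact_mem_nhds x
    obtain ⟨B, hB⟩ := eventually_atTop.1 (havoid D hD)
    refine ⟨D, hxD, (Set.finite_lt_nat B).subset fun l hl => ?_⟩
    by_contra hlt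
    exact (Set.not_disjoint_iff_nonempty_inter.2 hl) (hB l (not_lt.1 hlt)).symm
  -- The compact sets are thickened to open links without creating new intersections; staying inside
  -- `N` preserves `sm`.
  obtain ⟨T, hTo, hCT, hTd⟩ :=
    (hlf.comp_injective hφ.injective).exists_open_expansion (fun j => (hCc _).isClosed)
      (fun j => ⟨_, hzC _⟩)
      (fun i j hij => Set.not_nonempty_iff_eq_empty.1 (hφd i j hij) |> disjoint_iff_inter_eq_empty.2)
  have hQ : ∀ j, ∃ Q, IsOpen Q ∧ C (φ j) ⊆ Q ∧ closure Q ⊆ T j ∩ N (φ j) ∧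
      IsCompact (closure Q) := fun j =>
    exists_open_between_and_isCompact_closure (hCc _) ((hTo j).inter (hNo _))
      (subset_inter (hCT j) (hCN _))
  choose Q hQo hCQ hQT hQc using hQ
  choose y hy hy' using hφs
  have hCO : ∀ j, C (φ j) ⊆ connectedComponentIn (Q j) (z (φ j)) := fun j =>
    (hCp _).subset_connectedComponentIn (hzC _) (hCQ j)
  have hOQ : ∀ j, closure (connectedComponentIn (Q j) (z (φ j))) ⊆ closure (Q j) := fun j =>
    closure_mono (connectedComponentIn_subset _ _)
  have hON : ∀ j, closure (connectedComponentIn (Q j) (z (φ j))) ⊆ N (φ j) := fun j =>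
    (hOQ j).trans ((hQT j).trans inter_subset_right)
  refine ⟨{ link := fun j => connectedComponentIn (Q j) (z (φ j))
            pt := fun j => if j = 0 then z (φ 0) else y (j - 1)
            isOpen_link := fun j => (hQo j).connectedComponentIn
            isPreconnected_link := fun j => isPreconnected_connectedComponentIn
            pt_mem := ?_
            pt_succ_mem := fun j => by simpa using hCO j (hy j)
            eventually_subset := fun i => (hφ.tendsto_atTop.eventually (hNV i)).mono
              fun j hj => subset_closure.trans ((hON j).trans hj)
            isCompact_closure := fun j => (hQc j).of_isClosed_subset isClosed_closure (hOQ j)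
            disjoint := fun i j hij => (hTd i j hij).mono
              ((hOQ i).trans ((hQT i).trans inter_subset_left))
              ((hOQ j).trans ((hQT j).trans inter_subset_left)) },
    fun j => lab (φ j), by simp [hφ0, hlab0], hlabm.comp hφ.monotone,
    hlabt.comp hφ.tendsto_atTop, fun j => ⟨(hON j).trans (hNG _), hNsm _ _ (hON j)⟩⟩
  intro j
  cases j with
  | zero => simpa using hCO 0 (hzC _)
  | succ j => simpa using hCO (j + 1) (hy' j)

/-- A chain `O'` whose links are small and are spread monotonically over the links of `O`; no link
of `O'` is the only one inside an inner link of `O`. -/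
structure OpenChain.IsRefinement {X : Type*} [MetricSpace X] {V : ℕ → Set X} (O O' : OpenChain V)
    (lab : ℕ → ℕ) (δ : ℝ) : Prop where
  lab_zero : lab 0 = 0
  lab_succ : ∀ j, lab (j + 1) = lab j ∨ lab (j + 1) = lab j + 1
  tendsto_lab : Tendsto lab atTop atTop
  closure_subset : ∀ j, closure (O'.link j) ⊆ O.link (lab j)
  dist_le : ∀ j, ∀ x ∈ closure (O'.link j), ∀ y ∈ closure (O'.link j), dist x y ≤ δ
  not_single : ∀ j, ¬ (lab (j + 1) = lab j + 1 ∧ lab (j + 2) = lab (j + 1) + 1)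

/-- Distant links have disjoint closures, so every small set misses one of the two neighbours of an
inner link. A lone refined link would have to meet both. Writing the inner index as `k + 1` exempts
link `0`. -/
theorem OpenChain.exists_isRefinement {X : Type*} [MetricSpace X] [LocallyConnectedSpace X]
    [LocallyCompactSpace X] {V : ℕ → Set X} (hV : ∀ C, IsCompact C → ∃ i, Disjoint C (V i))
    (O : OpenChain V) {δ : ℝ} (hδ : 0 < δ) :
    ∃ (O' : OpenChain V) (lab : ℕ → ℕ), O.IsRefinement O' lab δ := by
  obtain ⟨O', lab, h0, hm, ht, h⟩ := O.toOpenTrail.exists_refinement hV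
    (sm := fun i N => (∀ x ∈ N, ∀ y ∈ N, dist x y ≤ δ) ∧
      ∀ k, k + 1 = i → Disjoint N (O.link k) ∨ Disjoint N (O.link (k + 2))) (by
    intro i x hx
    refine .and ?_ ?_
    · refine eventually_smallSets.2 ⟨Metric.ball x (δ / 2), Metric.ball_mem_nhds x (half_pos hδ),
        fun t ht a ha b hb => ?_⟩
      have h1 := Metric.mem_ball.1 (ht ha)
      have h2 := Metric.mem_ball.1 (ht hb)
      linarith [dist_triangle_right a b x]
    · rcases i with _ | k
      · exact .of_forall fun N k hk => absurd hk (by omega)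
      have key : ∀ l, x ∉ closure (O.link l) →
          ∀ᶠ N in (𝓝 x).smallSets, Disjoint N (O.link l) := fun l hl =>
        eventually_smallSets.2 ⟨(closure (O.link l))ᶜ, isClosed_closure.isOpen_compl.mem_nhds hl,
          fun t ht => disjoint_left.2 fun a ha hal => ht ha (subset_closure hal)⟩
      by_cases hxk : x ∈ closure (O.link k)
      · filter_upwards [key (k + 2) fun h => (O.disjoint k (k + 2) le_rfl).le_bot ⟨hxk, h⟩]
          with N hN l hl
        obtain rfl : l = k := by omega
        exact .inr hN
      · filter_upwards [key k hxk] with N hN l hl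
        obtain rfl : l = k := by omega
        exact .inl hN)
  have hO : ∀ j, O'.link j ⊆ O.link (lab j) := fun j => subset_closure.trans (h j).1
  refine ⟨O', lab, h0, fun j => ?_, ht, fun j => (h j).1, fun j => (h j).2.1, ?_⟩
  · by_contra hne
    have := hm (Nat.le_add_right j 1)
    refine (O.disjoint (lab j) (lab (j + 1)) (by omega)).le_bot ⟨subset_closure (hO j
      (O'.pt_succ_mem j)), subset_closure (hO (j + 1) (O'.pt_mem (j + 1)))⟩
  · rintro j ⟨h1, h2⟩
    rcases (h (j + 1)).2.2 (lab j) h1.symm with hd | hd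
    · exact hd.le_bot ⟨subset_closure (O'.pt_mem (j + 1)), hO j (O'.pt_succ_mem j)⟩
    · refine hd.le_bot ⟨subset_closure (O'.pt_succ_mem (j + 1)), ?_⟩
      have := hO (j + 2) (O'.pt_mem (j + 2))
      rwa [h2, h1] at this

/-! ### Subdivisions of the half-line and the limit ray. -/

/-- A division of a half-line with division points `s i` has a subdivision whose `j`-th interval
lies in the `lab j`-th one, with inner intervals at most half as long. -/
theorem exists_subdivision {s : ℕ → ℝ} (hs : StrictMono s) (hst : Tendsto s atTop atTop)
    {lab : ℕ → ℕ} (h0 : lab 0 = 0) (hsucc : ∀ j, lab (j + 1) = lab j ∨ lab (j + 1) = lab j + 1)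
    (ht : Tendsto lab atTop atTop)
    (hns : ∀ j, ¬ (lab (j + 1) = lab j + 1 ∧ lab (j + 2) = lab (j + 1) + 1)) :
    ∃ s' : ℕ → ℝ, s' 0 = s 0 ∧ StrictMono s' ∧ Tendsto s' atTop atTop ∧
      (∀ j, s (lab j) ≤ s' j ∧ s' (j + 1) ≤ s (lab j + 1)) ∧
      ∀ j, 1 ≤ lab j → s' (j + 1) - s' j ≤ (s (lab j + 1) - s (lab j)) / 2 := by
  -- While the label stays the same, the remainder of the old interval is halved; the last new
  -- interval with that label takes what is left.
  let s' : ℕ → ℝ := fun j => Nat.rec (s 0)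
    (fun j a => if lab (j + 1) = lab j then (a + s (lab j + 1)) / 2 else s (lab j + 1)) j
  have hs' : ∀ j, s' (j + 1) =
      if lab (j + 1) = lab j then (s' j + s (lab j + 1)) / 2 else s (lab j + 1) := fun j => rfl
  have hmem : ∀ j, s (lab j) ≤ s' j ∧ s' j < s (lab j + 1) := by
    intro j
    induction j with
    | zero => rw [h0]; exact ⟨le_rfl, hs zero_lt_one⟩
    | succ j ih =>
      rw [hs']
      split_ifs with h
      · rw [h]; constructor <;> linarith [ih.1, ih.2]
      · rw [(hsucc j).resolve_left h]
        exact ⟨le_rfl, hs (Nat.lt_succ_self _)⟩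
  have hlt : ∀ j, s' j < s' (j + 1) ∧ s' (j + 1) ≤ s (lab j + 1) := by
    intro j
    have := (hmem j).2
    rw [hs']
    split_ifs with h
    · constructor <;> linarith
    · exact ⟨this, le_rfl⟩
  refine ⟨s', rfl, strictMono_nat_of_lt_succ fun j => (hlt j).1,
    tendsto_atTop_mono (fun j => (hmem j).1) (hst.comp ht), fun j => ⟨(hmem j).1, (hlt j).2⟩,
    fun j hj => ?_⟩
  obtain ⟨h1, h2⟩ := hmem j
  rw [hs']
  split_ifs with h
  · linarith
  -- The last interval is not the only one with its label, so `s' j` came from a halving and lies at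
  -- or beyond the midpoint.
  · have h3 := (hsucc j).resolve_left h
    rcases j with _ | j
    · omega
    have h4 : lab (j + 1) = lab j := by
      have := hns j
      rcases hsucc j with h5 | h5
      · exact h5
      · exact absurd ⟨h5, h3⟩ this
    have h5 := hs' j
    rw [if_pos h4] at h5
    have h6 := (hmem j).1
    rw [← h4] at h5 h6
    linarith

/-- A sequence of open chains refining each other determines an injective ray that eventually
stays inside each of the sets `V i`. -/
theorem OpenChain.exists_injective_ray {X : Type*} [MetricSpace X] {V : ℕ → Set X}
    {c : ℕ → OpenChain V} {lab : ℕ → ℕ → ℕ}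
    (hc : ∀ n, (c n).IsRefinement (c (n + 1)) (lab n) ((1 / 2) ^ n)) :
    ∃ r : ℝ≥0 → X, Continuous r ∧ Function.Injective r ∧ ∀ i, ∀ᶠ t in atTop, r t ∈ V i := by
  have hsub : ∀ (n : ℕ) (s : {s : ℕ → ℝ // StrictMono s ∧ Tendsto s atTop atTop}),
      ∃ s' : {s : ℕ → ℝ // StrictMono s ∧ Tendsto s atTop atTop},
        (∀ j, s.1 (lab n j) ≤ s'.1 j ∧ s'.1 (j + 1) ≤ s.1 (lab n j + 1)) ∧ s'.1 0 = s.1 0 ∧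
        ∀ j, 1 ≤ lab n j → s'.1 (j + 1) - s'.1 j ≤ (s.1 (lab n j + 1) - s.1 (lab n j)) / 2 := by
    rintro n ⟨s, hs, hst⟩
    obtain ⟨s', h1, h2, h3, h4, h5⟩ := exists_subdivision hs hst (hc n).lab_zero (hc n).lab_succ
      (hc n).tendsto_lab (hc n).not_single
    exact ⟨⟨s', h2, h3⟩, h4, h1, h5⟩
  choose next hnext hnext0 hgap using hsub
  let S : ℕ → {s : ℕ → ℝ // StrictMono s ∧ Tendsto s atTop atTop} := fun n =>
    Nat.rec ⟨fun j => (j : ℝ), Nat.strictMono_cast, tendsto_natCast_atTop_atTop⟩ next n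
  let s : ℕ → ℕ → ℝ := fun n => (S n).1
  have hsm : ∀ n, StrictMono (s n) := fun n => (S n).2.1
  have hs_zero : ∀ n, s n 0 = 0 := by
    intro n
    induction n with
    | zero => exact Nat.cast_zero
    | succ n ih => exact (hnext0 n (S n)).trans ih
  have hs_one : ∀ n, s n 1 ≤ 1 := by
    intro n
    induction n with
    | zero => exact Nat.cast_one.le
    | succ n ih =>
      have := (hnext n (S n) 0).2
      rw [(hc n).lab_zero] at this
      exact this.trans ih
  -- The shift by `1` keeps the parameter out of interval `0` at every stage, where the lengths need
  -- not shrink.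
  have hJ : ∀ (n : ℕ) (t : ℝ≥0), ∃ j, s n j ≤ t + 1 ∧ (t : ℝ) + 1 < s n (j + 1) := by
    intro n t
    have hex : ∃ j, (t : ℝ) + 1 < s n (j + 1) :=
      (((tendsto_add_atTop_iff_nat 1).2 (S n).2.2).eventually_gt_atTop _).exists
    classical
    refine ⟨Nat.find hex, ?_, Nat.find_spec hex⟩
    rcases h : Nat.find hex with _ | j
    · rw [hs_zero]; positivity
    · exact not_lt.1 (Nat.find_min hex (m := j) (by omega))
  choose J hJl hJr using hJ
  have hJle : ∀ {n j} {t : ℝ≥0}, s n j ≤ t + 1 → j ≤ J n t := fun h =>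
    Nat.lt_succ_iff.1 ((hsm _).lt_iff_lt.1 (h.trans_lt (hJr _ _)))
  have hleJ : ∀ {n j} {t : ℝ≥0}, (t : ℝ) + 1 < s n (j + 1) → J n t ≤ j := fun h =>
    Nat.lt_succ_iff.1 ((hsm _).lt_iff_lt.1 ((hJl _ _).trans_lt h))
  have hlabJ : ∀ n t, lab n (J (n + 1) t) = J n t := fun n t =>
    le_antisymm (hJle ((hnext n (S n) _).1.trans (hJl (n + 1) t)))
      (hleJ ((hJr (n + 1) t).trans_le (hnext n (S n) _).2))
  have hJpos : ∀ n t, 1 ≤ J n t := fun n t =>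
    hJle ((hs_one n).trans (le_add_of_nonneg_left t.2))
  have hmesh : ∀ n t, s n (J n t + 1) - s n (J n t) ≤ (1 / 2) ^ n := by
    intro n t
    induction n with
    | zero => simp [s, S]
    | succ n ih =>
      have := hgap n (S n) (J (n + 1) t) (by rw [hlabJ]; exact hJpos n t)
      rw [hlabJ] at this
      change s (n + 1) (J (n + 1) t + 1) - s (n + 1) (J (n + 1) t) ≤
        (s n (J n t + 1) - s n (J n t)) / 2 at this
      rw [pow_succ]
      linarith
  have hsubset : ∀ n t, closure ((c (n + 1)).link (J (n + 1) t)) ⊆ (c n).link (J n t) :=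
    fun n t => hlabJ n t ▸ (hc n).closure_subset _
  have hr : ∀ t, ∃ x, ∀ n, x ∈ closure ((c n).link (J n t)) := by
    intro t
    obtain ⟨x, hx⟩ := IsCompact.nonempty_iInter_of_sequence_nonempty_isCompact_isClosed
      (fun n => closure ((c n).link (J n t))) (fun n => (hsubset n t).trans subset_closure)
      (fun n => ⟨_, subset_closure ((c n).pt_mem _)⟩) ((c 0).isCompact_closure _)
      (fun n => isClosed_closure)
    exact ⟨x, mem_iInter.1 hx⟩
  choose r hr using hr
  refine ⟨r, ?_, ?_, fun i => ?_⟩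
  · rw [Metric.continuous_iff']
    intro t ε hε
    obtain ⟨n, hn⟩ := exists_pow_lt_of_lt_one (half_pos hε) (show (1 / 2 : ℝ) < 1 by norm_num)
    -- As `t + 1` may be a division point, nearby parameters can select the preceding link too; two
    -- adjacent links cost at most `2 * (1 / 2) ^ n`.
    obtain ⟨j, hj⟩ : ∃ j, J (n + 1) t = j + 1 := Nat.exists_eq_add_of_le' (hJpos (n + 1) t)
    have hcont : Continuous fun t : ℝ≥0 => (t : ℝ) + 1 := by fun_prop
    have h1 : s (n + 1) j < t + 1 := ((hsm (n + 1)) (by omega)).trans_le (hJl (n + 1) t)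
    filter_upwards [(hcont.tendsto t).eventually_const_lt h1,
      (hcont.tendsto t).eventually_lt_const (hJr (n + 1) t)] with u hu1 hu2
    have h2 : j ≤ J (n + 1) u := hJle hu1.le
    have h3 : J (n + 1) u ≤ J (n + 1) t := hleJ hu2
    have ht := hr t (n + 1)
    have hu := hr u (n + 1)
    rw [hj] at h3 ht
    have hd := (hc n).dist_le
    rcases (show J (n + 1) u = j ∨ J (n + 1) u = j + 1 by omega) with h4 | h4
    · rw [h4] at hu
      have h5 := hd _ _ hu _ (subset_closure ((c (n + 1)).pt_succ_mem j))
      have h6 := hd _ _ (subset_closure ((c (n + 1)).pt_mem (j + 1))) _ ht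
      linarith [dist_triangle (r u) ((c (n + 1)).pt (j + 1)) (r t)]
    · rw [h4] at hu
      linarith [hd _ _ hu _ ht]
  · have hne : ∀ t u : ℝ≥0, t < u → r t ≠ r u := by
      intro t u htu he
      have htu' : (0 : ℝ) < u - t := sub_pos.2 (NNReal.coe_lt_coe.2 htu)
      obtain ⟨n, hn⟩ := exists_pow_lt_of_lt_one (half_pos htu') (show (1 / 2 : ℝ) < 1 by norm_num)
      -- Equal or adjacent intervals would give `u - t ≤ 2 * (1 / 2) ^ n`.
      have h2 : J n t + 2 ≤ J n u := by
        by_contra! hlt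
        have h3 : s n (J n u) ≤ s n (J n t + 1) := (hsm n).monotone (by omega)
        linarith [hmesh n t, hmesh n u, hJl n t, hJr n u]
      exact ((c n).disjoint _ _ h2).le_bot ⟨hr t n, he ▸ hr u n⟩
    intro t u he
    rcases lt_trichotomy t u with h | h | h
    · exact absurd he (hne t u h)
    · exact h
    · exact absurd he.symm (hne u t h)
  · obtain ⟨B, hB⟩ := eventually_atTop.1 ((c 0).eventually_subset i)
    filter_upwards [eventually_ge_atTop (B : ℝ≥0)] with t ht
    refine hB (J 0 t) (hJle ?_) (hsubset 0 t (hr t 1))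
    have : (B : ℝ) ≤ t := by exact_mod_cast ht
    exact this.trans (by linarith)

/-! ### Properness and the end of the ray. -/

/-- A sequence of nested connected open sets that leaves every compact set contains a properly
embedded ray. -/
theorem exists_proper_ray {X : Type*} [MetricSpace X] [LocallyConnectedSpace X]
    [LocallyCompactSpace X] {V : ℕ → Set X} (hV : ∀ C, IsCompact C → ∃ i, Disjoint C (V i))
    (hVo : ∀ i, IsOpen (V i)) (hVp : ∀ i, IsPreconnected (V i)) (hVne : ∀ i, (V i).Nonempty)
    (hVa : Antitone V) :
    ∃ r : ℝ≥0 → X, IsProperMap r ∧ IsEmbedding r ∧ ∀ i, ∀ᶠ t in atTop, r t ∈ V i := by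
  choose p hp using hVne
  let G : OpenTrail V :=
    { link := V
      pt := p
      isOpen_link := hVo
      isPreconnected_link := hVp
      pt_mem := hp
      pt_succ_mem := fun j => hVa (Nat.le_succ j) (hp (j + 1))
      eventually_subset := fun i => (eventually_ge_atTop i).mono fun j hj => hVa hj }
  obtain ⟨O, -⟩ := G.exists_refinement hV (sm := fun _ _ => True) fun _ _ _ => .of_forall fun _ =>
    trivial
  choose f lab hf using fun (n : ℕ) (O : OpenChain V) =>
    O.exists_isRefinement hV (δ := (1 / 2) ^ n) (by positivity)
  let c : ℕ → OpenChain V := fun n => Nat.rec O f n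
  obtain ⟨r, hrc, hri, hrV⟩ := OpenChain.exists_injective_ray (c := c)
    (lab := fun n => lab n (c n)) fun n => hf n (c n)
  have hproper : IsProperMap r := by
    refine isProperMap_iff_isCompact_preimage.2 ⟨hrc, fun C hC => ?_⟩
    obtain ⟨i, hi⟩ := hV C hC
    obtain ⟨B, hB⟩ := eventually_atTop.1 (hrV i)
    refine (isCompact_Icc (a := 0) (b := B)).of_isClosed_subset (hC.isClosed.preimage hrc)
      fun t ht => ⟨zero_le, ?_⟩
    by_contra hlt
    exact hi.le_bot ⟨ht, hB t (not_le.1 hlt).le⟩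
  exact ⟨r, hproper, (IsClosedEmbedding.of_continuous_injective_isClosedMap hrc hri
    hproper.isClosedMap).isEmbedding, hrV⟩

/-- A proper ray that eventually lies in each term of the end `ε` points to `ε`. -/
theorem CompactExhaustion.pointsTo_of_eventually_mem {X : Type*} [TopologicalSpace X]
    {K : CompactExhaustion X} {r : ℝ≥0 → X} (hr : IsProperMap r) {ε : K.Ends}
    (h : ∀ i, ∀ᶠ t in atTop, r t ∈ ε.comp i) : K.PointsTo hr ε := by
  refine Ends.ext (funext fun i => K.endsMap_comp_eq hr _ i (ε.comp_mem i) ?_)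
  obtain ⟨B, hB⟩ := eventually_atTop.1 (h i)
  obtain ⟨⟨x, -, hx⟩, -⟩ := ε.comp_mem i
  rintro _ ⟨t, ht, rfl⟩
  -- The connected tail `r '' Ici t` avoids `K i` and meets `ε.comp i` at this point, so it lies in
  -- that component.
  have hm : r (max t B) ∈ ε.comp i := hB _ (le_max_right _ _)
  have hsub : r '' Ici t ⊆ (K i)ᶜ := by
    rintro _ ⟨u, hu, rfl⟩
    exact ht u hu
  have hpre : IsPreconnected (r '' Ici t) := isPreconnected_Ici.image _ hr.continuous.continuousOn
  rw [hx] at hm ⊢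
  rw [connectedComponentIn_eq hm]
  exact hpre.subset_connectedComponentIn ⟨_, le_max_left t B, rfl⟩ hsub ⟨t, self_mem_Ici, rfl⟩

/-- The set of ends of `X` is the set of ends with respect to any compact exhaustion `K`. -/
theorem mainTheorem8 {X : Type*} [TopologicalSpace X] [GeneralizedContinuum X]
    [TopologicalSpace.MetrizableSpace X] [NoncompactSpace X] (K : CompactExhaustion X) :
    Nonempty K.Ends ∧
      ∀ ε : K.Ends, ∃ (r : ℝ≥0 → X) (hr : IsProperMap r), IsEmbedding r ∧ K.PointsTo hr ε := by
  refine ⟨GeneralizedContinuum.nonempty_ends K, fun ε => ?_⟩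
  let _ : MetricSpace X := TopologicalSpace.metrizableSpaceMetric X
  have hcomp : ∀ i, ∃ x ∈ (K i)ᶜ, ε.comp i = connectedComponentIn (K i)ᶜ x := fun i =>
    (ε.comp_mem i).1
  choose x hx hεx using hcomp
  obtain ⟨r, hr, hre, hrε⟩ := exists_proper_ray (V := ε.comp)
    (fun C hC => by
      obtain ⟨i, hi⟩ := K.exists_superset_of_isCompact hC
      refine ⟨i, disjoint_left.2 fun y hy hyε => ?_⟩
      rw [hεx] at hyε
      exact connectedComponentIn_subset _ _ hyε (hi hy))
    (fun i => hεx i ▸ (K.isCompact i).isClosed.isOpen_compl.connectedComponentIn)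
    (fun i => hεx i ▸ isPreconnected_connectedComponentIn)
    (fun i => hεx i ▸ ⟨x i, mem_connectedComponentIn (hx i)⟩)
    (antitone_nat_of_succ_le ε.comp_succ_subset)
  exact ⟨r, hr, hre, K.pointsTo_of_eventually_mem hr hrε⟩
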